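/- Let $B_\infty$ be Artin's braid group, generated by $\sigma_1,\sigma_2,\dots$ with relations $\sigma_i\sigma_j=\sigma_j\sigma_i$ for $|i-j|\ge 2$ and $\sigma_i\sigma_j\sigma_i=\sigma_j\sigma_i\sigma_j$ for $|i-j|=1$. Let $\mathrm{sh}$ be the endomorphism of $B_\infty$ with $\mathrm{sh}(\sigma_i)=\sigma_{i+1}$ for all $i$, and put $a\triangleright b=a\,\mathrm{sh}(b)\,\sigma_1\,\mathrm{sh}(a)^{-1}$. Then $(B_\infty,\triangleright)$ is a left-shelf, that is, $\triangleright$ obeys the law (LD) $x\triangleright(y\triangleright z)=(x\triangleright y)\triangleright(x\triangleright z)$. Let $\mathcal T_x$ be the set of all terms built from one variable $x$ with a binary operation symbol $\triangleright$, and let $=_{LD}$ be the congruence on $\mathcal T_x$ generated by the instances of (LD). (1) For every braid $a\in B_\infty$, the sub-left-shelf of $(B_\infty,\triangleright)$ generated by $a$ is a free left-shelf of rank $1$ based on $a$: for every left-shelf $T$ and every $t\in T$, there is exactly one homomorphism from it to $T$ that maps $a$ to $t$. (2) In particular, the special braids (those obtained from $1$ by iterating $\triangleright$) form a left-shelf isomorphic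 to $\mathrm{Free}_1=\mathcal T_x/{=_{LD}}$, by an isomorphism that maps the class of $x$ to $1$. (3) Define the braid word $\mathrm{eval}(t)$ for $t\in\mathcal T_x$ by letting $\mathrm{eval}(x)$ be the empty word and letting $\mathrm{eval}(t_0\triangleright t_1)$ be the concatenation of $\mathrm{eval}(t_0)$, $\mathrm{sh}(\mathrm{eval}(t_1))$, $\sigma_1$ and $\mathrm{sh}(\mathrm{eval}(t_0))^{-1}$, where $\mathrm{sh}$ increases the index of each letter by $1$ and ${}^{-1}$ is formal inversion. The function $\mathrm{eval}$ is computable. For every function $\mathrm{Equiv}$ that decides whether two braid words represent the same element of $B_\infty$, the algorithm that on input $(t,t')$ returns $\mathrm{Equiv}(\mathrm{eval}(t),\mathrm{eval}(t'))$ returns true if and only if $t=_{LD}t'$, and it is computable if $\mathrm{Equiv}$ is. Moreover, the relation $=_{LD}$ on $\mathcal T_x$ is decidable. -/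

import Mathlib

open scoped Quandles

universe w

/-! ### Left-shelves: generation, terms, freeness

Mathlib's `Shelf` is a set with one operation `x ◃ y` satisfying the left selfdistributivity law
`x ◃ (y ◃ z) = (x ◃ y) ◃ (x ◃ z)`, that is, a left-shelf. -/

/-- The closure of a set `s` under the operation of a left-shelf. -/
inductive ShelfClosure {S : Type*} [Shelf S] (s : Set S) : S → Prop
  | basic (x : S) : x ∈ s → ShelfClosure s x
  | act (x y : S) : ShelfClosure s x → ShelfClosure s y → ShelfClosure s (x ◃ y)

/-- The sub-left-shelf of `S` generated by a single element `a`. -/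
abbrev SubShelf {S : Type*} [Shelf S] (a : S) : Type _ := {x : S // ShelfClosure {a} x}

instance SubShelf.instShelf {S : Type*} [Shelf S] (a : S) : Shelf (SubShelf a) where
  act x y := ⟨x.1 ◃ y.1, ShelfClosure.act x.1 y.1 x.2 y.2⟩
  self_distrib := Subtype.ext Shelf.self_distrib

/-- The generator `a` of the sub-left-shelf generated by `a`. -/
def SubShelf.gen {S : Type*} [Shelf S] (a : S) : SubShelf a :=
  ⟨a, ShelfClosure.basic a rfl⟩

/-- `S` is a free left-shelf based on the family `b` (universal property). -/
def IsFreeShelfOn.{t, u, v} {X : Type u} {S : Type v} [Shelf S] (b : X → S) : Prop :=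
  ∀ (T : Type t) [Shelf T] (f : X → T), ∃! φ : S →◃ T, ∀ x, φ (b x) = f x

/-- LD-equivalence of terms: the congruence on the absolutely free algebra `FreeMagma X` generated
by the instances of the left selfdistributivity law. -/
def ldCon (X : Type*) : Con (FreeMagma X) :=
  conGen fun u v => ∃ x y z : FreeMagma X, u = x * (y * z) ∧ v = (x * y) * (x * z)

/-- The left-shelf of LD-classes of terms with variables in `X`. -/
abbrev FreeShelf (X : Type*) : Type _ := (ldCon X).Quotient

instance FreeShelf.instShelf (X : Type*) : Shelf (FreeShelf X) where
  act x y := x * y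
  self_distrib := by
    rintro ⟨x⟩ ⟨y⟩ ⟨z⟩
    exact (Con.eq (ldCon X)).2 (ConGen.Rel.of _ _ ⟨x, y, z, rfl, rfl⟩)

/-- The class of the variable `x`. -/
def FreeShelf.of {X : Type*} (x : X) : FreeShelf X :=
  ((FreeMagma.of x : FreeMagma X) : (ldCon X).Quotient)

/-! ### The braid group on infinitely many strands and the braid left-shelf

The generators are indexed from `0`: `i` stands for the Artin generator `σ_{i+1}`. -/

/-- The defining relators of the braid group. -/
def braidRels : Set (FreeGroup ℕ) :=
  {r | ∃ i j : ℕ, (i + 2 ≤ j ∨ j + 2 ≤ i) ∧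
      r = (FreeGroup.of i * FreeGroup.of j) * (FreeGroup.of j * FreeGroup.of i)⁻¹} ∪
  {r | ∃ i j : ℕ, (i + 1 = j ∨ j + 1 = i) ∧
      r = (FreeGroup.of i * FreeGroup.of j * FreeGroup.of i) *
        (FreeGroup.of j * FreeGroup.of i * FreeGroup.of j)⁻¹}

/-- Artin's braid group `B_∞`. -/
abbrev Braid : Type := PresentedGroup braidRels

namespace Braid

/-- The Artin generator `σ_{i+1}`. -/
def sigma (i : ℕ) : Braid := PresentedGroup.of i

theorem sigma_comm {i j : ℕ} (h : i + 2 ≤ j ∨ j + 2 ≤ i) :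
    sigma i * sigma j = sigma j * sigma i := by
  have h1 := PresentedGroup.one_of_mem (rels := braidRels) (Or.inl ⟨i, j, h, rfl⟩)
  rw [map_mul, map_inv, mul_inv_eq_one, map_mul, map_mul] at h1
  exact h1

theorem sigma_braid {i j : ℕ} (h : i + 1 = j ∨ j + 1 = i) :
    sigma i * sigma j * sigma i = sigma j * sigma i * sigma j := by
  have h1 := PresentedGroup.one_of_mem (rels := braidRels) (Or.inr ⟨i, j, h, rfl⟩)
  rw [map_mul, map_inv, mul_inv_eq_one, map_mul, map_mul, map_mul, map_mul] at h1
  exact h1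

theorem shift_rels : ∀ r ∈ braidRels, FreeGroup.lift (fun i => sigma (i + 1)) r = 1 := by
  rintro r (⟨i, j, h, rfl⟩ | ⟨i, j, h, rfl⟩)
  · simp only [map_mul, map_inv, FreeGroup.lift_apply_of, mul_inv_eq_one]
    exact sigma_comm (by omega)
  · simp only [map_mul, map_inv, FreeGroup.lift_apply_of, mul_inv_eq_one]
    exact sigma_braid (by omega)

/-- The shift endomorphism, mapping each `σ_i` to `σ_{i+1}`. -/
def sh : Braid →* Braid := PresentedGroup.toGroup shift_rels

theorem sh_sigma (i : ℕ) : sh (sigma i) = sigma (i + 1) :=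
  PresentedGroup.toGroup.of shift_rels

theorem sigma_zero_comm_sh_sh (a : Braid) : sigma 0 * sh (sh a) = sh (sh a) * sigma 0 := by
  have h : Commute (sigma 0) (sh (sh a)) := by
    refine PresentedGroup.induction_on (rels := braidRels)
      (C := fun a => Commute (sigma 0) (sh (sh a))) a fun w => ?_
    induction w using FreeGroup.induction_on with
    | C1 => simp
    | of i =>
      change Commute (sigma 0) (sh (sh (sigma i)))
      rw [sh_sigma, sh_sigma]
      exact sigma_comm (by omega)
    | inv_of i ih => simpa only [map_inv] using ih.inv_right
    | mul x y hx hy => simpa only [map_mul] using hx.mul_right hy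
  exact h

/-- The braid left-shelf: `a ◃ b = a · sh(b) · σ₁ · sh(a)⁻¹`. -/
instance instShelf : Shelf Braid where
  act a b := a * sh b * sigma 0 * (sh a)⁻¹
  self_distrib := by
    intro a b c
    have hb : sigma 0 * sigma 1 * sigma 0 = sigma 1 * sigma 0 * sigma 1 :=
      sigma_braid (Or.inl rfl)
    have e : sigma 0 * sigma 1 * sigma 0 * (sigma 1)⁻¹ = sigma 1 * sigma 0 := by
      rw [hb]; group
    have ha : (sh (sh a))⁻¹ * sigma 0 * sh (sh a) = sigma 0 := by
      rw [mul_assoc, sigma_zero_comm_sh_sh]; group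
    have hc := sigma_zero_comm_sh_sh c
    have hbi : sigma 0 * (sh (sh b))⁻¹ = (sh (sh b))⁻¹ * sigma 0 := by
      simpa only [map_inv] using sigma_zero_comm_sh_sh b⁻¹
    simp only [map_mul, map_inv, sh_sigma, mul_inv_rev, inv_inv, zero_add]
    symm
    calc _ = a * sh b * (sigma 0 * sh (sh c)) * sigma 1 *
            ((sh (sh a))⁻¹ * sigma 0 * sh (sh a)) * (sigma 1)⁻¹ *
            (sh (sh b))⁻¹ * (sh a)⁻¹ := by group
      _ = a * sh b * sh (sh c) * (sigma 0 * sigma 1 * sigma 0 * (sigma 1)⁻¹) *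
            (sh (sh b))⁻¹ * (sh a)⁻¹ := by rw [ha, hc]; group
      _ = a * sh b * sh (sh c) * sigma 1 * (sigma 0 * (sh (sh b))⁻¹) * (sh a)⁻¹ := by
            rw [e]; group
      _ = _ := by rw [hbi]; group

end Braid

/-- The left-shelf of special braids: those obtained from `1` by iterating the operation `◃`. -/
abbrev SpecialBraid : Type := SubShelf (1 : Braid)

/-! ### Braid words and the semantic algorithm -/

/-- Braid words: `(i, true)` is the letter `σ_{i+1}` and `(i, false)` is its inverse. -/
abbrev BraidWord : Type := List (ℕ × Bool)

/-- The braid represented by a braid word. -/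
def BraidWord.toBraid (w : BraidWord) : Braid := PresentedGroup.mk braidRels (FreeGroup.mk w)

/-- Shifting of braid words. -/
def BraidWord.shift (w : BraidWord) : BraidWord := w.map fun p => (p.1 + 1, p.2)

/-- Formal inversion of braid words. -/
def BraidWord.inverse (w : BraidWord) : BraidWord := (w.map fun p => (p.1, !p.2)).reverse

/-- Terms in one variable. -/
abbrev Term1 : Type := FreeMagma Unit

/-- Evaluation of a term in one variable as a braid word. -/
def evalWord : Term1 → BraidWord
  | FreeMagma.of _ => []
  | FreeMagma.mul s t =>
    evalWord s ++ BraidWord.shift (evalWord t) ++ [(0, true)] ++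
      BraidWord.inverse (BraidWord.shift (evalWord s))

/-- `equiv` is a solution of the word problem of the braid group. -/
def SolvesBraidWordProblem (equiv : BraidWord → BraidWord → Bool) : Prop :=
  ∀ w w' : BraidWord, equiv w w' = true ↔ w.toBraid = w'.toBraid

/-- The semantic algorithm, with `equiv` called on the evaluations of the two terms. -/
def semanticAlgorithm (equiv : BraidWord → BraidWord → Bool) (t t' : Term1) : Bool :=
  equiv (evalWord t) (evalWord t')

/-- The code of a term: `0` for the variable, `⟨code s, code t⟩ + 1` for `s * t`. -/
def Term1.code : Term1 → ℕ
  | FreeMagma.of _ => 0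
  | FreeMagma.mul s t => Nat.pair (Term1.code s) (Term1.code t) + 1

/-- The term with a given code. -/
def Term1.decode : ℕ → Term1
  | 0 => FreeMagma.of ()
  | n + 1 =>
    have _h1 : n.unpair.1 < n + 1 := Nat.lt_succ_of_le n.unpair_left_le
    have _h2 : n.unpair.2 < n + 1 := Nat.lt_succ_of_le n.unpair_right_le
    FreeMagma.mul (Term1.decode n.unpair.1) (Term1.decode n.unpair.2)

/-- The Gödel numbering of terms in one variable. -/
def Term1.equivNat : Term1 ≃ ℕ where
  toFun := Term1.code
  invFun := Term1.decode
  left_inv := by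
    intro t
    induction t with
    | of x => rw [Term1.code, Term1.decode]
    | mul s t hs ht =>
      change Term1.decode (Nat.pair (Term1.code s) (Term1.code t) + 1) = FreeMagma.mul s t
      rw [Term1.decode]
      simp only [Nat.unpair_pair, hs, ht]
  right_inv := by
    intro n
    induction n using Nat.strong_induction_on with
    | _ n ih =>
      cases n with
      | zero => rw [Term1.decode, Term1.code]
      | succ n =>
        rw [Term1.decode, Term1.code, ih _ (Nat.lt_succ_of_le n.unpair_left_le),
          ih _ (Nat.lt_succ_of_le n.unpair_right_le), Nat.pair_unpair]

instance Term1.instPrimcodable : Primcodable Term1 := Primcodable.ofEquiv ℕ Term1.equivNat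

/-!
The proof compares terms with one another, and compares their values in braids with one another.

*Terms.* Orienting (LD) as `r * (s * t) ↦ (r * s) * (r * t)` gives a confluent rewriting relation:
the term `full t`, obtained by distributing left factors all the way down, is an expansion of every
one-step expansion of `t`, and `full` preserves expansions (`FreeMagma.Expands.join`). In one
variable `x`, every term `t` satisfies `t * xⁿ = xⁿ⁺¹` up to LD-equivalence, where `xⁿ` is a large
right power (`FreeMagma.exists_mul_rightPow`). Hence, for any two terms `s` and `t`, the terms
`s * xⁿ` and `t * xⁿ` have a common expansion. Expansions of `s` and of `t` occur in it as iterated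
left subterms, so one of them is a left subterm of the other
(`FreeMagma.exists_ldCon_isLeftSubterm`).

*Braids.* Since `a⁻¹ (a ◃ b) = sh(b) σ₁ sh(a)⁻¹`, if `s` is a proper left subterm of `t` then the
values of `s` and `t` in braids differ by a braid with a word in which `σ₁` occurs and `σ₁⁻¹` does
not. Such a braid is not trivial, by Larue's argument with the Artin action on a free group: `σ₁`
maps `x₀⁻¹` to a reduced word that begins with `x₀`, and `σ₁` and all shifted braids map words that
begin with `x₀` to words that begin with `x₀` (`Braid.isPositive_sh_mul_sigma_mul_sh`,
`Braid.IsPositive.artin_ne`). So terms with equal values at any braid `a` are LD-equivalent, which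
is freeness.

*Decidability.* The argument shows more: LD-equivalence of `s` and `t` holds if and only if the
braid `eval(s)⁻¹ eval(t)` fixes the single element `x₀⁻¹` (`Braid.ldCon_iff_artin`). This condition
is a primitive recursive computation with reduced words, and no solution of the word problem of
the braid group is needed.
-/

/-! ### Expansions of terms and confluence -/

namespace FreeMagma

variable {X : Type*}

/-- One-step LD-expansion: left selfdistributivity is applied once to a subterm, in the direction
`r * (s * t) ↦ (r * s) * (r * t)`. -/
inductive Expand : FreeMagma X → FreeMagma X → Prop
  | root (r s t : FreeMagma X) : Expand (r * (s * t)) ((r * s) * (r * t))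
  | left {s s' : FreeMagma X} (t : FreeMagma X) : Expand s s' → Expand (s * t) (s' * t)
  | right (s : FreeMagma X) {t t' : FreeMagma X} : Expand t t' → Expand (s * t) (s * t')

/-- LD-expansion in any number of steps. -/
abbrev Expands : FreeMagma X → FreeMagma X → Prop := Relation.ReflTransGen Expand

theorem Expands.mul {s s' t t' : FreeMagma X} (hs : Expands s s') (ht : Expands t t') :
    Expands (s * t) (s' * t') :=
  (hs.lift (· * t) fun _ _ h => h.left t).trans (ht.lift (s' * ·) fun _ _ h => h.right s')

/-- `dist s t` distributes `s` in `t` all the way down to the variables: each variable `x` of `t`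
is replaced by `s * x`. -/
def dist (s : FreeMagma X) : FreeMagma X → FreeMagma X
  | of x => s * of x
  | mul t u => dist s t * dist s u

theorem dist_mul (s t u : FreeMagma X) : dist s (t * u) = dist s t * dist s u := rfl

theorem mul_expands_dist (s t : FreeMagma X) : Expands (s * t) (dist s t) := by
  induction t with
  | ih1 x => exact .refl
  | ih2 t u ht hu => exact .head (.root s t u) (ht.mul hu)

theorem dist_expands_left {s s' : FreeMagma X} (h : Expands s s') (t : FreeMagma X) :
    Expands (dist s t) (dist s' t) := by
  induction t with
  | ih1 x => exact h.mul .refl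
  | ih2 t u ht hu => exact ht.mul hu

theorem Expand.dist (s : FreeMagma X) {t t' : FreeMagma X} (h : Expand t t') :
    Expand (FreeMagma.dist s t) (FreeMagma.dist s t') := by
  induction h with
  | root a b c => exact .root _ _ _
  | left u _ ih => exact ih.left _
  | right u _ ih => exact ih.right _

theorem Expands.dist {s s' t t' : FreeMagma X} (hs : Expands s s') (ht : Expands t t') :
    Expands (FreeMagma.dist s t) (FreeMagma.dist s' t') :=
  (dist_expands_left hs t).trans (ht.lift _ fun _ _ h => h.dist s')

/-- Distribution satisfies left selfdistributivity up to expansion. -/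
theorem dist_dist_expands (r s t : FreeMagma X) :
    Expands (dist r (dist s t)) (dist (dist r s) (dist r t)) := by
  induction t with
  | ih1 x => exact mul_expands_dist (dist r s) (r * of x)
  | ih2 t u ht hu => exact ht.mul hu

/-- The term in which, from the innermost products outwards, each left factor has been distributed
in the right factor. -/
def full : FreeMagma X → FreeMagma X
  | of x => of x
  | mul s t => dist (full s) (full t)

theorem full_mul (s t : FreeMagma X) : full (s * t) = dist (full s) (full t) := rfl

theorem expands_full (t : FreeMagma X) : Expands t (full t) := by
  induction t with
  | ih1 x => exact .refl
  | ih2 s t hs ht => exact (hs.mul ht).trans (mul_expands_dist _ _)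

/-- `full t` is an expansion of all one-step expansions of `t`. -/
theorem Expand.expands_full {t t' : FreeMagma X} (h : Expand t t') : Expands t' (full t) := by
  induction h with
  | root r s t =>
    have h := (Expands.mul (r * s).expands_full (r * t).expands_full)
    simp only [full_mul, ← dist_mul] at h
    exact h.trans (Expands.dist .refl (mul_expands_dist _ _))
  | left t _ ih => exact (Expands.mul ih t.expands_full).trans (mul_expands_dist _ _)
  | right s _ ih => exact (Expands.mul s.expands_full ih).trans (mul_expands_dist _ _)

theorem Expand.full {t t' : FreeMagma X} (h : Expand t t') :
    Expands (FreeMagma.full t) (FreeMagma.full t') := by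
  induction h with
  | root r s t => exact dist_dist_expands _ _ _
  | left t _ ih => exact Expands.dist ih .refl
  | right s _ ih => exact Expands.dist .refl ih

theorem Expands.full {t t' : FreeMagma X} (h : Expands t t') :
    Expands (FreeMagma.full t) (FreeMagma.full t') := by
  induction h with
  | refl => exact .refl
  | tail _ h ih => exact ih.trans h.full

/-- Confluence of LD-expansion. -/
theorem Expands.join {t u v : FreeMagma X} (hu : Expands t u) (hv : Expands t v) :
    Relation.Join Expands u v := by
  -- The expansions of `t` that `full t` still dominates have the diamond property.
  let R : FreeMagma X → FreeMagma X → Prop := fun t t' =>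
    Expands t t' ∧ Expands t' (FreeMagma.full t)
  have hR : ∀ {a b}, Relation.ReflTransGen R a b → Expands a b := fun h => by
    induction h with
    | refl => exact .refl
    | tail _ h ih => exact ih.trans h.1
  have lift : ∀ {a b}, Expands a b → Relation.ReflTransGen R a b := fun h =>
    h.lift id fun _ _ h => ⟨.single h, h.expands_full⟩
  obtain ⟨d, h1, h2⟩ := Relation.church_rosser (r := R)
    (fun a b c hb hc => ⟨a.full, .single ⟨hb.2, hb.1.full⟩, .single ⟨hc.2, hc.1.full⟩⟩)
    (lift hu) (lift hv)
  exact ⟨d, hR h1, hR h2⟩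

/-- LD-equivalent terms have a common LD-expansion. -/
theorem join_of_ldCon {s t : FreeMagma X} (h : ldCon X s t) : Relation.Join Expands s t := by
  induction h with
  | of u v h =>
    obtain ⟨x, y, z, rfl, rfl⟩ := h
    exact ⟨_, .single (.root x y z), .refl⟩
  | refl x => exact ⟨x, .refl, .refl⟩
  | symm _ ih => exact Relation.Join.symm.symm _ _ ih
  | trans _ _ h1 h2 =>
    obtain ⟨a, ha, ha'⟩ := h1
    obtain ⟨b, hb, hb'⟩ := h2
    obtain ⟨c, hc, hc'⟩ := ha'.join hb
    exact ⟨c, ha.trans hc, hb'.trans hc'⟩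
  | mul _ _ h1 h2 =>
    obtain ⟨a, ha, ha'⟩ := h1
    obtain ⟨b, hb, hb'⟩ := h2
    exact ⟨a * b, ha.mul hb, ha'.mul hb'⟩

theorem Expand.ldCon {s t : FreeMagma X} (h : Expand s t) : ldCon X s t := by
  induction h with
  | root r s t => exact ConGen.Rel.of _ _ ⟨r, s, t, rfl, rfl⟩
  | left t _ ih => exact (_root_.ldCon X).mul ih ((_root_.ldCon X).refl t)
  | right s _ ih => exact (_root_.ldCon X).mul ((_root_.ldCon X).refl s) ih

theorem Expands.ldCon {s t : FreeMagma X} (h : Expands s t) : ldCon X s t := by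
  induction h with
  | refl => exact (_root_.ldCon X).refl _
  | tail _ h ih => exact (_root_.ldCon X).trans ih h.ldCon

/-! ### Comparison of terms in one variable -/

/-- `s.IsLeftSubterm t`: the term `t` is `(⋯((s * t₁) * t₂)⋯) * tₙ` for some `n ≥ 0`. -/
inductive IsLeftSubterm (s : FreeMagma X) : FreeMagma X → Prop
  | refl : IsLeftSubterm s s
  | mul {t : FreeMagma X} (u : FreeMagma X) : IsLeftSubterm s t → IsLeftSubterm s (t * u)

theorem IsLeftSubterm.expand {s t t' : FreeMagma X} (h : Expand t t') (hs : IsLeftSubterm s t) :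
    ∃ s', Expands s s' ∧ IsLeftSubterm s' t' := by
  induction h with
  | root a b c =>
    cases hs with
    | refl => exact ⟨_, .single (.root a b c), .refl⟩
    | mul _ hs => exact ⟨s, .refl, (hs.mul b).mul _⟩
  | left u h ih =>
    cases hs with
    | refl => exact ⟨_, .single (.left u h), .refl⟩
    | mul _ hs =>
      obtain ⟨s', h1, h2⟩ := ih hs
      exact ⟨s', h1, h2.mul u⟩
  | right u h ih =>
    cases hs with
    | refl => exact ⟨_, .single (.right u h), .refl⟩
    | mul _ hs => exact ⟨s, .refl, hs.mul _⟩

/-- Left subterms survive expansions, up to expansion: an application of (LD) at the root moves a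
left subterm one level down, and other applications expand it or leave it alone. -/
theorem IsLeftSubterm.expands {s t t' : FreeMagma X} (h : Expands t t') (hs : IsLeftSubterm s t) :
    ∃ s', Expands s s' ∧ IsLeftSubterm s' t' := by
  induction h with
  | refl => exact ⟨s, .refl, hs⟩
  | tail _ h ih =>
    obtain ⟨s', h1, h2⟩ := ih
    obtain ⟨s'', h3, h4⟩ := h2.expand h
    exact ⟨s'', h1.trans h3, h4⟩

theorem IsLeftSubterm.total {s s' t : FreeMagma X} (h : IsLeftSubterm s t)
    (h' : IsLeftSubterm s' t) : IsLeftSubterm s s' ∨ IsLeftSubterm s' s := by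
  induction h with
  | refl => exact .inr h'
  | mul u h ih =>
    cases h' with
    | refl => exact .inl (h.mul u)
    | mul _ h' => exact ih h'

/-- The right powers of the variable: `x`, `x * x`, `x * (x * x)`, and so on. -/
def rightPow : ℕ → FreeMagma Unit
  | 0 => of ()
  | n + 1 => of () * rightPow n

/-- Every term in one variable acts on large right powers of the variable as the variable does. -/
theorem exists_mul_rightPow (t : FreeMagma Unit) :
    ∃ N, ∀ n, N ≤ n → ldCon Unit (t * rightPow n) (rightPow (n + 1)) := by
  induction t with
  | ih1 x => exact ⟨0, fun n _ => (ldCon Unit).refl _⟩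
  | ih2 s t hs ht =>
    obtain ⟨N, hN⟩ := hs
    obtain ⟨M, hM⟩ := ht
    refine ⟨max N M + 1, fun n hn => ?_⟩
    obtain ⟨k, rfl⟩ : ∃ k, n = k + 1 := ⟨n - 1, by omega⟩
    have h1 := (ldCon Unit).mul ((ldCon Unit).refl (s * t))
      ((ldCon Unit).symm (hN k (by omega)))
    have h2 : ldCon Unit (s * (t * rightPow k)) (s * t * (s * rightPow k)) :=
      ConGen.Rel.of _ _ ⟨s, t, rightPow k, rfl, rfl⟩
    have h3 := (ldCon Unit).mul ((ldCon Unit).refl s) (hM k (by omega))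
    exact (ldCon Unit).trans h1 ((ldCon Unit).trans ((ldCon Unit).symm h2)
      ((ldCon Unit).trans h3 (hN (k + 1) (by omega))))

/-- Comparison property: up to LD-equivalence, one of two terms in one variable is a left subterm
of the other. -/
theorem exists_ldCon_isLeftSubterm (s t : FreeMagma Unit) :
    ∃ s' t', ldCon Unit s s' ∧ ldCon Unit t t' ∧ (IsLeftSubterm s' t' ∨ IsLeftSubterm t' s') := by
  obtain ⟨N, hN⟩ := exists_mul_rightPow s
  obtain ⟨M, hM⟩ := exists_mul_rightPow t
  have h := (ldCon Unit).trans (hN (max N M) (le_max_left _ _))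
    ((ldCon Unit).symm (hM (max N M) (le_max_right _ _)))
  obtain ⟨v, hs, ht⟩ := join_of_ldCon h
  obtain ⟨s', h1, h2⟩ := (IsLeftSubterm.refl.mul _ : IsLeftSubterm s _).expands hs
  obtain ⟨t', h3, h4⟩ := (IsLeftSubterm.refl.mul _ : IsLeftSubterm t _).expands ht
  exact ⟨s', t', h1.ldCon, h3.ldCon, h2.total h4⟩

/-! ### Evaluation of terms in left-shelves and freeness -/

/-- The value of a term in a left-shelf, for an assignment of values to the variables. -/
def shelfEval {S : Type*} [Shelf S] (f : X → S) : FreeMagma X → S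
  | of x => f x
  | mul s t => shelfEval f s ◃ shelfEval f t

theorem shelfEval_mul {S : Type*} [Shelf S] (f : X → S) (s t : FreeMagma X) :
    shelfEval f (s * t) = shelfEval f s ◃ shelfEval f t := rfl

theorem shelfEval_eq_of_ldCon {S : Type*} [Shelf S] (f : X → S) {s t : FreeMagma X}
    (h : ldCon X s t) : shelfEval f s = shelfEval f t := by
  induction h with
  | of u v h =>
    obtain ⟨x, y, z, rfl, rfl⟩ := h
    exact Shelf.self_distrib
  | refl x => rfl
  | symm _ ih => exact ih.symm
  | trans _ _ h1 h2 => exact h1.trans h2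
  | mul _ _ h1 h2 => rw [shelfEval_mul, shelfEval_mul, h1, h2]

end FreeMagma

namespace FreeShelf

open FreeMagma

variable {X S : Type*} [Shelf S]

/-- The homomorphism from the left-shelf of LD-classes of terms given by values of the
variables. -/
def lift (f : X → S) : FreeShelf X →◃ S where
  toFun q := Con.liftOn q (shelfEval f) fun _ _ h => shelfEval_eq_of_ldCon f h
  map_act' := by
    rintro ⟨s⟩ ⟨t⟩
    rfl

theorem hom_coe (φ : FreeShelf X →◃ S) (t : FreeMagma X) :
    φ ((t : FreeMagma X) : (ldCon X).Quotient) = shelfEval (fun x => φ (of x)) t := by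
  induction t with
  | ih1 x => rfl
  | ih2 s t hs ht =>
    have h := φ.map_act (x := ((s : FreeMagma X) : (ldCon X).Quotient))
      (y := ((t : FreeMagma X) : (ldCon X).Quotient))
    rw [hs, ht] at h
    exact h

theorem isFreeShelfOn (X : Type*) : IsFreeShelfOn.{w} (FreeShelf.of (X := X)) := by
  intro T _ f
  refine ⟨lift f, fun x => rfl, fun ψ h => ?_⟩
  ext q
  rcases q with ⟨t⟩
  refine (hom_coe ψ t).trans ?_
  simp only [h]
  rfl

end FreeShelf

/-- Freeness is carried over by bijective homomorphisms. -/
theorem IsFreeShelfOn.of_bijective {X R S : Type*} [Shelf R] [Shelf S] {b : X → R}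
    (hb : IsFreeShelfOn.{w} b) (φ : R →◃ S) (hφ : Function.Bijective φ) :
    IsFreeShelfOn.{w} (fun x => φ (b x)) := by
  intro T _ f
  obtain ⟨ψ, hψ, huniq⟩ := hb T f
  let e := Equiv.ofBijective φ hφ
  have he : ∀ y, φ (e.symm y) = y := fun y => e.apply_symm_apply y
  have he' : ∀ x, e.symm (φ x) = x := fun x => e.symm_apply_apply x
  refine ⟨⟨fun y => ψ (e.symm y), fun {y z} => ?_⟩, fun x => ?_, fun χ hχ => ?_⟩
  · rw [← ψ.map_act]
    congr 1
    apply hφ.1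
    rw [φ.map_act, he, he, he]
  · change ψ (e.symm (φ (b x))) = f x
    rw [he', hψ]
  · have h := huniq (χ.comp φ) fun x => hχ x
    ext y
    change χ y = ψ (e.symm y)
    rw [← h]
    change χ y = χ (φ (e.symm y))
    rw [he]

namespace SubShelf

open FreeMagma

variable {S : Type*} [Shelf S]

theorem coe_shelfEval_gen (a : S) (t : FreeMagma Unit) :
    (shelfEval (fun _ => gen a) t : SubShelf a).1 = shelfEval (fun _ => a) t := by
  induction t with
  | ih1 x => rfl
  | ih2 s t hs ht =>
    rw [shelfEval_mul, shelfEval_mul, ← hs, ← ht]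
    rfl

theorem lift_gen_surjective (a : S) :
    Function.Surjective (FreeShelf.lift fun _ : Unit => gen a) := by
  rintro ⟨x, hx⟩
  induction hx with
  | basic x hx =>
    obtain rfl : x = a := hx
    exact ⟨FreeShelf.of (), rfl⟩
  | act x y hx hy ihx ihy =>
    obtain ⟨p, hp⟩ := ihx
    obtain ⟨q, hq⟩ := ihy
    refine ⟨p ◃ q, ?_⟩
    rw [ShelfHom.map_act, hp, hq]
    rfl

/-- A monogenerated left-shelf is the left-shelf of LD-classes as soon as the values of terms at its
generator separate LD-classes. -/
theorem lift_gen_bijective {a : S}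
    (h : ∀ s t : FreeMagma Unit,
      shelfEval (fun _ => a) s = shelfEval (fun _ => a) t → ldCon Unit s t) :
    Function.Bijective (FreeShelf.lift fun _ : Unit => gen a) := by
  refine ⟨fun p q hpq => ?_, lift_gen_surjective a⟩
  rcases p with ⟨s⟩
  rcases q with ⟨t⟩
  refine (Con.eq _).2 (h s t ?_)
  exact (coe_shelfEval_gen a s).symm.trans
    ((congrArg Subtype.val hpq).trans (coe_shelfEval_gen a t))

end SubShelf

/-! ### The Artin action of braids on a free group -/

namespace Braid

/-- The word by which the letter `σ_{i+1}` or its inverse, `p = (i, true)` or `p = (i, false)`,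
replaces a letter of a free group word: `σ_{i+1}` maps `xᵢ` to `xᵢ xᵢ₊₁ xᵢ⁻¹` and `xᵢ₊₁` to
`xᵢ`, and fixes the other generators. The letters of free group words are encoded like those of
braid words. -/
def letterImage (p q : ℕ × Bool) : List (ℕ × Bool) :=
  if p.2 = true then
    if q.1 = p.1 then [(p.1, true), (p.1 + 1, q.2), (p.1, false)]
    else if q.1 = p.1 + 1 then [(p.1, q.2)] else [q]
  else
    if q.1 = p.1 then [(p.1 + 1, q.2)]
    else if q.1 = p.1 + 1 then [(p.1 + 1, false), (p.1, q.2), (p.1 + 1, true)] else [q]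

/-- The endomorphism of the free group given by a letter of braid words. -/
def artinHom (p : ℕ × Bool) : FreeGroup ℕ →* FreeGroup ℕ :=
  FreeGroup.lift fun k => FreeGroup.mk (letterImage p (k, true))

theorem artinHom_of (p : ℕ × Bool) (k : ℕ) :
    artinHom p (FreeGroup.of k) = FreeGroup.mk (letterImage p (k, true)) := by
  simp [artinHom]

theorem mk_letterImage (p q : ℕ × Bool) :
    FreeGroup.mk (letterImage p q) = artinHom p (FreeGroup.mk [q]) := by
  obtain ⟨k, _ | _⟩ := q
  · have h : (FreeGroup.mk [(k, false)] : FreeGroup ℕ) = (FreeGroup.of k)⁻¹ := by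
      simp [FreeGroup.of, FreeGroup.inv_mk, FreeGroup.invRev]
    rw [h, map_inv, artinHom_of, FreeGroup.inv_mk]
    unfold letterImage FreeGroup.invRev
    dsimp only
    split_ifs <;> rfl
  · exact (artinHom_of p k).symm

theorem mk_flatMap_letterImage (p : ℕ × Bool) (L : List (ℕ × Bool)) :
    FreeGroup.mk (L.flatMap (letterImage p)) = artinHom p (FreeGroup.mk L) := by
  induction L with
  | nil => simp [← FreeGroup.one_eq_mk]
  | cons q L ih =>
    rw [List.flatMap_cons, ← FreeGroup.mul_mk, ih, mk_letterImage, ← map_mul, FreeGroup.mul_mk]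
    rfl

theorem artinHom_true_of_self (i : ℕ) : artinHom (i, true) (FreeGroup.of i) =
    FreeGroup.of i * FreeGroup.of (i + 1) * (FreeGroup.of i)⁻¹ := by
  rw [artinHom_of]
  simp [letterImage, FreeGroup.of, FreeGroup.inv_mk, FreeGroup.invRev]

theorem artinHom_true_of_succ (i : ℕ) :
    artinHom (i, true) (FreeGroup.of (i + 1)) = FreeGroup.of i := by
  rw [artinHom_of]
  simp [letterImage, FreeGroup.of]

theorem artinHom_false_of_self (i : ℕ) :
    artinHom (i, false) (FreeGroup.of i) = FreeGroup.of (i + 1) := by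
  rw [artinHom_of]
  simp [letterImage, FreeGroup.of]

theorem artinHom_false_of_succ (i : ℕ) : artinHom (i, false) (FreeGroup.of (i + 1)) =
    (FreeGroup.of (i + 1))⁻¹ * FreeGroup.of i * FreeGroup.of (i + 1) := by
  rw [artinHom_of]
  simp [letterImage, FreeGroup.of, FreeGroup.inv_mk, FreeGroup.invRev]

theorem artinHom_of_ne {i k : ℕ} (b : Bool) (h : k ≠ i) (h' : k ≠ i + 1) :
    artinHom (i, b) (FreeGroup.of k) = FreeGroup.of k := by
  rw [artinHom_of]
  simp [letterImage, FreeGroup.of, h, h']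

theorem artinHom_comp_not (i : ℕ) (b : Bool) :
    (artinHom (i, b)).comp (artinHom (i, !b)) = MonoidHom.id _ := by
  ext k
  simp only [MonoidHom.comp_apply, MonoidHom.id_apply]
  by_cases h : k = i
  · subst h
    cases b <;> simp [artinHom_true_of_self, artinHom_true_of_succ, artinHom_false_of_self,
      artinHom_false_of_succ, mul_assoc]
  by_cases h' : k = i + 1
  · subst h'
    cases b <;> simp [artinHom_true_of_self, artinHom_true_of_succ, artinHom_false_of_self,
      artinHom_false_of_succ, mul_assoc]
  · rw [artinHom_of_ne _ h h', artinHom_of_ne _ h h']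

/-- The automorphism of the free group given by an Artin generator. -/
def artinAut (i : ℕ) : MulAut (FreeGroup ℕ) :=
  MonoidHom.toMulEquiv (artinHom (i, true)) (artinHom (i, false))
    (artinHom_comp_not i false) (artinHom_comp_not i true)

theorem artinAut_apply (i : ℕ) (g : FreeGroup ℕ) : artinAut i g = artinHom (i, true) g := rfl

theorem artinAut_inv_apply (i : ℕ) (g : FreeGroup ℕ) :
    (artinAut i)⁻¹ g = artinHom (i, false) g := rfl

theorem mulAut_ext {α : Type*} {φ ψ : MulAut (FreeGroup α)}
    (h : ∀ k, φ (FreeGroup.of k) = ψ (FreeGroup.of k)) : φ = ψ := by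
  have h1 : φ.toMonoidHom = ψ.toMonoidHom := FreeGroup.ext_hom _ _ h
  exact MulEquiv.ext fun g => DFunLike.congr_fun h1 g

theorem artinAut_comm {i j : ℕ} (h : i + 2 ≤ j) :
    artinAut i * artinAut j = artinAut j * artinAut i := by
  refine mulAut_ext fun k => ?_
  simp only [MulAut.mul_apply, artinAut_apply]
  by_cases h1 : k = i
  · subst h1
    simp [artinHom_true_of_self, artinHom_of_ne (i := j) (k := k) true (by omega) (by omega),
      artinHom_of_ne (i := j) (k := k + 1) true (by omega) (by omega)]
  by_cases h2 : k = i + 1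
  · subst h2
    simp [artinHom_true_of_succ, artinHom_of_ne (i := j) (k := i) true (by omega) (by omega),
      artinHom_of_ne (i := j) (k := i + 1) true (by omega) (by omega)]
  by_cases h3 : k = j
  · subst h3
    simp [artinHom_true_of_self, artinHom_of_ne (i := i) (k := k) true (by omega) (by omega),
      artinHom_of_ne (i := i) (k := k + 1) true (by omega) (by omega)]
  by_cases h4 : k = j + 1
  · subst h4
    simp [artinHom_true_of_succ, artinHom_of_ne (i := i) (k := j) true (by omega) (by omega),
      artinHom_of_ne (i := i) (k := j + 1) true (by omega) (by omega)]
  · simp [artinHom_of_ne (i := i) true h1 h2, artinHom_of_ne (i := j) true h3 h4]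

theorem artinAut_braid (i : ℕ) : artinAut i * artinAut (i + 1) * artinAut i =
    artinAut (i + 1) * artinAut i * artinAut (i + 1) := by
  refine mulAut_ext fun k => ?_
  simp only [MulAut.mul_apply, artinAut_apply]
  have h1 : artinHom (i + 1, true) (FreeGroup.of i) = FreeGroup.of i :=
    artinHom_of_ne true (by omega) (by omega)
  have h2 : artinHom (i, true) (FreeGroup.of (i + 2)) = FreeGroup.of (i + 2) :=
    artinHom_of_ne true (by omega) (by omega)
  have h3 := artinHom_true_of_self i
  have h4 := artinHom_true_of_succ i
  have h5 : artinHom (i + 1, true) (FreeGroup.of (i + 1)) =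
      FreeGroup.of (i + 1) * FreeGroup.of (i + 2) * (FreeGroup.of (i + 1))⁻¹ :=
    artinHom_true_of_self (i + 1)
  have h6 : artinHom (i + 1, true) (FreeGroup.of (i + 2)) = FreeGroup.of (i + 1) :=
    artinHom_true_of_succ (i + 1)
  by_cases e1 : k = i
  · subst e1
    simp [h1, h2, h3, h4, h5, mul_assoc]
  by_cases e2 : k = i + 1
  · subst e2
    simp [h1, h2, h3, h4, h5, h6]
  by_cases e3 : k = i + 2
  · subst e3
    simp [h1, h2, h4, h6]
  · simp [artinHom_of_ne (i := i) true e1 e2, artinHom_of_ne (i := i + 1) true e2 e3]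

theorem artin_rels : ∀ r ∈ braidRels, FreeGroup.lift artinAut r = 1 := by
  rintro r (⟨i, j, h, rfl⟩ | ⟨i, j, h, rfl⟩)
  · simp only [map_mul, map_inv, FreeGroup.lift_apply_of, mul_inv_eq_one]
    exact h.elim artinAut_comm fun h => (artinAut_comm h).symm
  · simp only [map_mul, map_inv, FreeGroup.lift_apply_of, mul_inv_eq_one]
    rcases h with rfl | rfl
    · exact artinAut_braid i
    · exact (artinAut_braid j).symm

/-- The Artin representation of the braid group by automorphisms of a free group. -/
def artin : Braid →* MulAut (FreeGroup ℕ) := PresentedGroup.toGroup artin_rels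

theorem artin_sigma (i : ℕ) : artin (sigma i) = artinAut i :=
  PresentedGroup.toGroup.of artin_rels

theorem toBraid_cons (p : ℕ × Bool) (u : BraidWord) :
    BraidWord.toBraid (p :: u) = BraidWord.toBraid [p] * BraidWord.toBraid u := by
  rw [BraidWord.toBraid, BraidWord.toBraid, BraidWord.toBraid, ← map_mul, FreeGroup.mul_mk]
  rfl

theorem artin_toBraid_singleton (p : ℕ × Bool) (g : FreeGroup ℕ) :
    artin (BraidWord.toBraid [p]) g = artinHom p g := by
  obtain ⟨i, _ | _⟩ := p
  · have h : BraidWord.toBraid [(i, false)] = (sigma i)⁻¹ := by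
      change PresentedGroup.mk braidRels (FreeGroup.of i)⁻¹ = _
      rw [map_inv]
      rfl
    rw [h, map_inv, artin_sigma, artinAut_inv_apply]
  · change artin (sigma i) g = _
    rw [artin_sigma, artinAut_apply]

/-- The word obtained from a free group word by letting a braid word act on it, unreduced. -/
def actWord (u : BraidWord) (L : List (ℕ × Bool)) : List (ℕ × Bool) :=
  u.foldr (fun p L => L.flatMap (letterImage p)) L

theorem mk_actWord (u : BraidWord) (L : List (ℕ × Bool)) :
    FreeGroup.mk (actWord u L) = artin u.toBraid (FreeGroup.mk L) := by
  induction u with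
  | nil =>
    have h : BraidWord.toBraid [] = 1 := map_one (PresentedGroup.mk braidRels)
    rw [h, map_one]
    rfl
  | cons p u ih =>
    rw [toBraid_cons, map_mul, MulAut.mul_apply, ← ih, artin_toBraid_singleton,
      ← mk_flatMap_letterImage]
    rfl

/-! ### Words that begin with the first generator -/

/-- How the reduced image of a free group word under `σ_{i+1}` begins, according to how the reduced
word begins. What may follow the first letter is part of the description as far as it matters for
the cancellations caused by a further letter in front. -/
def ImageShape (i : ℕ) : List (ℕ × Bool) → List (ℕ × Bool) → Prop
  | [], R => R = []
  | (k, b) :: _, R =>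
    if k = i then ∃ R', R = (i, true) :: (i + 1, b) :: R'
    else if k = i + 1 then
      if b = true then ∃ R', R = (i, true) :: R' ∧ ∀ c, R'.head? ≠ some (i + 1, c)
      else (∃ c R', R = (i + 1, c) :: R') ∨ ∃ R', R = (i, false) :: R'
    else ∃ R', R = (k, b) :: R'

/-- Reduction of a concatenation, as a fold that only sees the reduced form of the second word. -/
theorem reduce_append_eq (L M : List (ℕ × Bool)) : FreeGroup.reduce (L ++ M) =
    L.foldr (fun p R => match R with
      | [] => [p]
      | q :: R => if p.1 = q.1 ∧ p.2 = !q.2 then R else p :: q :: R) (FreeGroup.reduce M) := by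
  induction L with
  | nil => rfl
  | cons p L ih =>
    rw [List.cons_append, FreeGroup.reduce.cons, ih, List.foldr_cons]
    split <;> simp_all

/-- A letter in front of a reduced word is not the inverse of the first letter, so the shape of the
image of the longer word follows from that of the shorter one. -/
theorem imageShape_reduce (i : ℕ) {L : List (ℕ × Bool)} (hL : FreeGroup.IsReduced L) :
    ImageShape i L (FreeGroup.reduce (L.flatMap (letterImage (i, true)))) := by
  induction L with
  | nil => rfl
  | cons q L ih =>
    obtain ⟨k, b⟩ := q
    rw [List.flatMap_cons]
    cases L with
    | nil =>
      unfold ImageShape letterImage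
      dsimp only
      split_ifs <;> simp_all [FreeGroup.reduce]
    | cons q' L =>
      obtain ⟨k', b'⟩ := q'
      have h0 : k = k' → b = b' := (FreeGroup.isReduced_cons_cons.1 hL).1
      replace ih := ih (FreeGroup.isReduced_cons_cons.1 hL).2
      revert ih
      generalize ((k', b') :: L).flatMap (letterImage (i, true)) = M
      unfold ImageShape
      dsimp only
      have hl : letterImage (i, true) (k, b) = if k = i then [(i, true), (i + 1, b), (i, false)]
        else if k = i + 1 then [(i, b)] else [(k, b)] := rfl
      rw [hl]
      rw [reduce_append_eq]
      generalize FreeGroup.reduce M = R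
      intro ih
      split_ifs at ih ⊢ with h1 h2 h3 h4 h5 h6
      all_goals grind
/-- The reduced word of `g` begins with the letter `x₀`. -/
def BeginsZero (g : FreeGroup ℕ) : Prop := g.toWord.head? = some (0, true)

theorem imageShape_toWord (i : ℕ) (g : FreeGroup ℕ) :
    ImageShape i g.toWord (artin (sigma i) g).toWord := by
  have h := imageShape_reduce i (FreeGroup.isReduced_toWord (x := g))
  rwa [← FreeGroup.toWord_mk, mk_flatMap_letterImage, FreeGroup.mk_toWord, ← artinAut_apply,
    ← artin_sigma] at h

/-- The equivalence also covers the inverses of the generators other than `σ₁`. -/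
theorem beginsZero_artin_sigma_succ_iff (i : ℕ) (g : FreeGroup ℕ) :
    BeginsZero (artin (sigma (i + 1)) g) ↔ BeginsZero g := by
  have h := imageShape_toWord (i + 1) g
  unfold BeginsZero
  generalize (artin (sigma (i + 1)) g).toWord = R at h ⊢
  generalize g.toWord = L at h ⊢
  unfold ImageShape at h
  grind

theorem BeginsZero.artin_sigma_zero {g : FreeGroup ℕ} (hg : BeginsZero g) :
    BeginsZero (artin (sigma 0) g) := by
  have h := imageShape_toWord 0 g
  unfold BeginsZero at hg ⊢
  generalize (artin (sigma 0) g).toWord = R at h ⊢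
  generalize g.toWord = L at h hg
  unfold ImageShape at h
  grind

theorem beginsZero_artin_sh_iff (b : Braid) (g : FreeGroup ℕ) :
    BeginsZero (artin (sh b) g) ↔ BeginsZero g := by
  revert g
  refine PresentedGroup.induction_on (rels := braidRels)
    (C := fun b => ∀ g, BeginsZero (artin (sh b) g) ↔ BeginsZero g) b fun w => ?_
  induction w using FreeGroup.induction_on with
  | C1 => simp
  | of i =>
    intro g
    change BeginsZero (artin (sh (sigma i)) g) ↔ _
    rw [sh_sigma, beginsZero_artin_sigma_succ_iff]
  | inv_of i ih =>
    intro g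
    rw [← ih, ← MulAut.mul_apply]
    simp
  | mul x y hx hy =>
    intro g
    rw [map_mul, map_mul, map_mul, MulAut.mul_apply, hx, hy]

theorem artin_sh_of_zero (b : Braid) :
    artin (sh b) (FreeGroup.of 0) = FreeGroup.of 0 := by
  refine PresentedGroup.induction_on (rels := braidRels)
    (C := fun b => artin (sh b) (FreeGroup.of 0) = FreeGroup.of 0) b fun w => ?_
  induction w using FreeGroup.induction_on with
  | C1 => simp
  | of i =>
    change artin (sh (sigma i)) _ = _
    rw [sh_sigma, artin_sigma, artinAut_apply, artinHom_of_ne true (by omega) (by omega)]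
  | inv_of i ih =>
    nth_rw 1 [← ih]
    simp [← MulAut.mul_apply]
  | mul x y hx hy => rw [map_mul, map_mul, map_mul, MulAut.mul_apply, hy, hx]

/-! ### Positive braids and freeness -/

/-- The braid maps `x₀⁻¹`, and every word that begins with `x₀`, to a word that begins with `x₀`.
Braids represented by a word with at least one letter `σ₁` and no letter `σ₁⁻¹` have this
property. -/
def IsPositive (b : Braid) : Prop :=
  BeginsZero (artin b (FreeGroup.of 0)⁻¹) ∧ ∀ g, BeginsZero g → BeginsZero (artin b g)

theorem IsPositive.mul {b c : Braid} (hb : IsPositive b) (hc : IsPositive c) :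
    IsPositive (b * c) := by
  refine ⟨?_, fun g hg => ?_⟩
  · rw [map_mul, MulAut.mul_apply]
    exact hb.2 _ hc.1
  · rw [map_mul, MulAut.mul_apply]
    exact hb.2 _ (hc.2 _ hg)

theorem isPositive_sh_mul_sigma_mul_sh (b c : Braid) : IsPositive (sh b * sigma 0 * sh c) := by
  have h : BeginsZero (artin (sigma 0) (FreeGroup.of 0)⁻¹) := by
    rw [artin_sigma, artinAut_apply, map_inv, artinHom_true_of_self]
    unfold BeginsZero
    have h : ((FreeGroup.of 0 * FreeGroup.of (0 + 1) * (FreeGroup.of 0)⁻¹)⁻¹ : FreeGroup ℕ) =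
      FreeGroup.mk [(0, true), (1, false), (0, false)] := by
      simp [FreeGroup.of, FreeGroup.inv_mk, FreeGroup.invRev]
    rw [h, FreeGroup.toWord_mk]
    rfl
  refine ⟨?_, fun g hg => ?_⟩
  · rw [map_mul, map_mul, MulAut.mul_apply, MulAut.mul_apply, beginsZero_artin_sh_iff, map_inv,
      artin_sh_of_zero]
    exact h
  · rw [map_mul, map_mul, MulAut.mul_apply, MulAut.mul_apply, beginsZero_artin_sh_iff]
    exact ((beginsZero_artin_sh_iff c g).2 hg).artin_sigma_zero

/-- A positive braid moves `x₀⁻¹`, in particular it is not trivial. -/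
theorem IsPositive.artin_ne {b : Braid} (hb : IsPositive b) :
    artin b (FreeGroup.of 0)⁻¹ ≠ (FreeGroup.of 0)⁻¹ := by
  intro h
  have h1 := hb.1
  rw [h, BeginsZero, FreeGroup.toWord_inv, FreeGroup.toWord_of] at h1
  simp [FreeGroup.invRev] at h1

theorem isPositive_inv_mul_act (a b : Braid) : IsPositive (a⁻¹ * (a ◃ b)) := by
  have h : a⁻¹ * (a ◃ b) = sh b * sigma 0 * sh a⁻¹ := by
    change a⁻¹ * (a * sh b * sigma 0 * (sh a)⁻¹) = _
    rw [map_inv]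
    group
  rw [h]
  exact isPositive_sh_mul_sigma_mul_sh _ _

open FreeMagma

theorem isPositive_of_isLeftSubterm (a : Braid) {s t : FreeMagma Unit} (h : IsLeftSubterm s t)
    (u : FreeMagma Unit) :
    IsPositive ((shelfEval (fun _ => a) s)⁻¹ * shelfEval (fun _ => a) (t * u)) := by
  induction h generalizing u with
  | refl => exact isPositive_inv_mul_act _ _
  | @mul t v h ih =>
    have h1 := (ih v).mul (isPositive_inv_mul_act (shelfEval (fun _ => a) (t * v))
      (shelfEval (fun _ => a) u))
    rw [mul_assoc, mul_inv_cancel_left] at h1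
    exact h1

/-- The values in braids of two terms that are not LD-equivalent differ by a positive braid. -/
theorem ldCon_or_isPositive (a : Braid) (s t : FreeMagma Unit) : ldCon Unit s t ∨
    IsPositive ((shelfEval (fun _ => a) s)⁻¹ * shelfEval (fun _ => a) t) ∨
    IsPositive ((shelfEval (fun _ => a) t)⁻¹ * shelfEval (fun _ => a) s) := by
  obtain ⟨s', t', hs, ht, hst⟩ := exists_ldCon_isLeftSubterm s t
  rw [shelfEval_eq_of_ldCon _ hs, shelfEval_eq_of_ldCon _ ht]
  rcases hst with hst | hst
  · cases hst with
    | refl => exact .inl ((ldCon Unit).trans hs ((ldCon Unit).symm ht))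
    | mul u hst => exact .inr (.inl (isPositive_of_isLeftSubterm a hst u))
  · cases hst with
    | refl => exact .inl ((ldCon Unit).trans hs ((ldCon Unit).symm ht))
    | mul u hst => exact .inr (.inr (isPositive_of_isLeftSubterm a hst u))

/-- LD-equivalence of terms is detected by the action on the single element `x₀⁻¹` of the free
group. -/
theorem ldCon_iff_artin (a : Braid) (s t : FreeMagma Unit) : ldCon Unit s t ↔
    artin ((shelfEval (fun _ => a) s)⁻¹ * shelfEval (fun _ => a) t) (FreeGroup.of 0)⁻¹ =
      (FreeGroup.of 0)⁻¹ := by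
  refine ⟨fun h => ?_, fun h => ?_⟩
  · rw [shelfEval_eq_of_ldCon _ h, inv_mul_cancel, map_one, MulAut.one_apply]
  · rcases ldCon_or_isPositive a s t with h1 | h1 | h1
    · exact h1
    · exact absurd h h1.artin_ne
    · refine absurd ?_ h1.artin_ne
      nth_rw 1 [← h]
      rw [← MulAut.mul_apply, ← map_mul]
      simp

theorem ldCon_iff_shelfEval_eq (a : Braid) (s t : FreeMagma Unit) :
    ldCon Unit s t ↔ shelfEval (fun _ => a) s = shelfEval (fun _ => a) t := by
  refine ⟨shelfEval_eq_of_ldCon _, fun h => (ldCon_iff_artin a s t).2 ?_⟩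
  rw [h, inv_mul_cancel, map_one, MulAut.one_apply]

theorem lift_gen_bijective (a : Braid) :
    Function.Bijective (FreeShelf.lift fun _ : Unit => SubShelf.gen a) :=
  SubShelf.lift_gen_bijective fun s t => (ldCon_iff_shelfEval_eq a s t).2

/-! ### Evaluation of terms by braid words -/

theorem toBraid_append (u v : BraidWord) :
    BraidWord.toBraid (u ++ v) = u.toBraid * v.toBraid := by
  rw [BraidWord.toBraid, BraidWord.toBraid, BraidWord.toBraid, ← map_mul, FreeGroup.mul_mk]

theorem toBraid_inverse (u : BraidWord) : u.inverse.toBraid = u.toBraid⁻¹ := by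
  rw [BraidWord.toBraid, BraidWord.toBraid, ← map_inv, FreeGroup.inv_mk]
  rfl

theorem toBraid_shift (u : BraidWord) : u.shift.toBraid = sh u.toBraid := by
  induction u with
  | nil => exact (map_one sh).symm
  | cons p u ih =>
    rw [toBraid_cons, map_mul, ← ih]
    change BraidWord.toBraid ((p.1 + 1, p.2) :: BraidWord.shift u) = _
    rw [toBraid_cons]
    congr 1
    obtain ⟨i, _ | _⟩ := p
    · have h := congrArg (·⁻¹) (sh_sigma i)
      rw [← map_inv] at h
      exact h.symm
    · exact (sh_sigma i).symm

theorem evalWord_mul (s t : Term1) : evalWord (s * t) =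
    evalWord s ++ BraidWord.shift (evalWord t) ++ [(0, true)] ++
      BraidWord.inverse (BraidWord.shift (evalWord s)) := rfl

theorem toBraid_evalWord (t : Term1) :
    (evalWord t).toBraid = shelfEval (fun _ => (1 : Braid)) t := by
  induction t with
  | of x => exact map_one (PresentedGroup.mk braidRels)
  | mul s t hs ht =>
    change BraidWord.toBraid (evalWord (s * t)) = _
    rw [evalWord_mul, toBraid_append, toBraid_append, toBraid_append, toBraid_inverse,
      toBraid_shift, toBraid_shift, hs, ht]
    rfl

theorem semanticAlgorithm_eq_true_iff {equiv : BraidWord → BraidWord → Bool}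
    (h : SolvesBraidWordProblem equiv) (s t : Term1) :
    semanticAlgorithm equiv s t = true ↔ ldCon Unit s t := by
  rw [semanticAlgorithm, h, toBraid_evalWord, toBraid_evalWord, ldCon_iff_shelfEval_eq 1]

/-- LD-equivalence as an equality of reduced words. -/
theorem ldCon_iff_reduce (s t : Term1) : ldCon Unit s t ↔
    FreeGroup.reduce (actWord ((evalWord s).inverse ++ evalWord t) [(0, false)]) =
      [(0, false)] := by
  have h : (FreeGroup.mk [(0, false)] : FreeGroup ℕ) = (FreeGroup.of 0)⁻¹ := by
    simp [FreeGroup.of, FreeGroup.inv_mk, FreeGroup.invRev]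
  rw [ldCon_iff_artin 1, ← toBraid_evalWord, ← toBraid_evalWord, ← toBraid_inverse,
    ← toBraid_append, ← h, ← mk_actWord, ← FreeGroup.toWord_inj, FreeGroup.toWord_mk,
    FreeGroup.toWord_mk]
  rfl

/-! ### Computability -/

theorem primrec_shift : Primrec BraidWord.shift :=
  Primrec.list_map .id (Primrec.pair (Primrec.succ.comp (Primrec.fst.comp .snd))
    (Primrec.snd.comp .snd)).to₂

theorem primrec_inverse : Primrec BraidWord.inverse :=
  Primrec.list_reverse.comp (Primrec.list_map .id (Primrec.pair (Primrec.fst.comp .snd)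
    (Primrec.not.comp (Primrec.snd.comp .snd))).to₂)

/-- The operation on braid words that `evalWord` makes of the product of terms. -/
def mulWord (u v : BraidWord) : BraidWord :=
  u ++ BraidWord.shift v ++ [(0, true)] ++ BraidWord.inverse (BraidWord.shift u)

theorem primrec_mulWord : Primrec₂ mulWord :=
  Primrec.list_append.comp
    (Primrec.list_append.comp
      (Primrec.list_append.comp .fst (primrec_shift.comp .snd)) (.const _))
    (primrec_inverse.comp (primrec_shift.comp .fst))

theorem primrec_evalWord : Primrec evalWord := by
  -- Terms are coded by numbers larger than the codes of their factors: strong recursion applies.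
  have key : Primrec₂ fun (_ : Unit) (n : ℕ) => evalWord (Term1.decode n) := by
    refine Primrec.nat_strong_rec _ (g := fun _ l => Nat.casesOn l.length (some [])
      fun n => (l[n.unpair.1]?).bind fun u => (l[n.unpair.2]?).map fun v => mulWord u v) ?_ ?_
    · refine Primrec.nat_casesOn (Primrec.list_length.comp .snd) (.const _) ?_
      refine Primrec.option_bind (Primrec.list_getElem?.comp (Primrec.snd.comp .fst)
        (Primrec.fst.comp (Primrec.unpair.comp .snd))) ?_
      refine Primrec.option_map (Primrec.list_getElem?.comp (Primrec.snd.comp (.comp .fst .fst))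
        (Primrec.snd.comp (Primrec.unpair.comp (.comp .snd .fst)))) ?_
      exact primrec_mulWord.comp (Primrec.snd.comp .fst) .snd
    · intro _ n
      cases n with
      | zero => simp [Term1.decode, evalWord]
      | succ n =>
        have h1 := Nat.lt_succ_of_le n.unpair_left_le
        have h2 := Nat.lt_succ_of_le n.unpair_right_le
        simp only [List.length_map, List.length_range, List.getElem?_map,
          List.getElem?_range h1, List.getElem?_range h2, Option.map_some, Option.bind_some]
        rw [Term1.decode]
        rfl
  refine (key.comp (.const ()) (Primrec.of_equiv (e := Term1.equivNat))).of_eq fun t => ?_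
  exact congrArg evalWord (Term1.equivNat.left_inv t)

theorem primrec_letterImage : Primrec₂ letterImage := by
  have hp : Primrec fun x : (ℕ × Bool) × (ℕ × Bool) => x.1.1 := Primrec.fst.comp .fst
  have hp' := Primrec.succ.comp hp
  have hb : Primrec fun x : (ℕ × Bool) × (ℕ × Bool) => x.2.2 := Primrec.snd.comp .snd
  have hq : Primrec fun x : (ℕ × Bool) × (ℕ × Bool) => x.2.1 := Primrec.fst.comp .snd
  have hnil : Primrec fun _ : (ℕ × Bool) × (ℕ × Bool) => ([] : List (ℕ × Bool)) := .const _
  have hsame : Primrec fun x : (ℕ × Bool) × (ℕ × Bool) => [x.2] :=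
    Primrec.list_cons.comp .snd hnil
  have h1 : PrimrecPred fun x : (ℕ × Bool) × (ℕ × Bool) => x.2.1 = x.1.1 := Primrec.eq.comp hq hp
  have h2 : PrimrecPred fun x : (ℕ × Bool) × (ℕ × Bool) => x.2.1 = x.1.1 + 1 :=
    Primrec.eq.comp hq hp'
  refine Primrec.ite (Primrec.eq.comp (Primrec.snd.comp .fst) (.const true)) ?_ ?_
  · refine Primrec.ite h1 ?_ (Primrec.ite h2 ?_ hsame)
    · exact Primrec.list_cons.comp (hp.pair (.const true)) (Primrec.list_cons.comp (hp'.pair hb)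
        (Primrec.list_cons.comp (hp.pair (.const false)) hnil))
    · exact Primrec.list_cons.comp (hp.pair hb) hnil
  · refine Primrec.ite h1 ?_ (Primrec.ite h2 ?_ hsame)
    · exact Primrec.list_cons.comp (hp'.pair hb) hnil
    · exact Primrec.list_cons.comp (hp'.pair (.const false)) (Primrec.list_cons.comp (hp.pair hb)
        (Primrec.list_cons.comp (hp'.pair (.const true)) hnil))

theorem primrec_actWord : Primrec₂ actWord := by
  refine Primrec.list_foldr (h := fun _ (x : (ℕ × Bool) × List (ℕ × Bool)) =>
    x.2.flatMap (letterImage x.1)) .fst .snd ?_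
  exact Primrec.list_flatMap (Primrec.snd.comp .snd)
    (primrec_letterImage.comp (Primrec.fst.comp (.comp .snd .fst)) .snd).to₂

theorem primrec_reduce : Primrec (FreeGroup.reduce (α := ℕ)) := by
  have h : Primrec fun L : List (ℕ × Bool) => L.foldr (fun p R => List.casesOn R [p]
      fun q R => if p.1 = q.1 ∧ p.2 = !q.2 then R else p :: q :: R) ([] : List (ℕ × Bool)) := by
    refine Primrec.list_foldr (h := fun _ (x : (ℕ × Bool) × List (ℕ × Bool)) =>
      List.casesOn x.2 [x.1] fun q R => if x.1.1 = q.1 ∧ x.1.2 = !q.2 then R else x.1 :: q :: R)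
      .id (.const _) ?_
    have hp : Primrec fun x : (List (ℕ × Bool) × (ℕ × Bool) × List (ℕ × Bool)) ×
        (ℕ × Bool) × List (ℕ × Bool) => x.1.2.1 := .comp .fst (.comp .snd .fst)
    have hq : Primrec fun x : (List (ℕ × Bool) × (ℕ × Bool) × List (ℕ × Bool)) ×
        (ℕ × Bool) × List (ℕ × Bool) => x.2.1 := .comp .fst .snd
    have hR : Primrec fun x : (List (ℕ × Bool) × (ℕ × Bool) × List (ℕ × Bool)) ×
        (ℕ × Bool) × List (ℕ × Bool) => x.2.2 := .comp .snd .snd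
    have hl : Primrec fun x : List (ℕ × Bool) × (ℕ × Bool) × List (ℕ × Bool) => x.2.2 :=
      .comp .snd .snd
    have hs : Primrec fun x : List (ℕ × Bool) × (ℕ × Bool) × List (ℕ × Bool) => [x.2.1] :=
      Primrec.list_cons.comp (.comp .fst .snd) (.const _)
    refine Primrec.list_casesOn (h := fun x (y : (ℕ × Bool) × List (ℕ × Bool)) =>
      if x.2.1.1 = y.1.1 ∧ x.2.1.2 = !y.1.2 then y.2 else x.2.1 :: y.1 :: y.2) hl hs ?_
    refine Primrec.ite (PrimrecPred.and ?_ ?_) hR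
      (Primrec.list_cons.comp hp (Primrec.list_cons.comp hq hR))
    · exact Primrec.eq.comp (Primrec.fst.comp hp) (Primrec.fst.comp hq)
    · exact Primrec.eq.comp (Primrec.snd.comp hp) (Primrec.not.comp (Primrec.snd.comp hq))
  refine h.of_eq fun L => ?_
  induction L with
  | nil => rfl
  | cons p L ih => rw [List.foldr_cons, ih, FreeGroup.reduce.cons]

theorem computablePred_ldCon :
    ComputablePred fun p : Term1 × Term1 => ldCon Unit p.1 p.2 := by
  have h : PrimrecPred fun p : Term1 × Term1 =>
      FreeGroup.reduce (actWord ((evalWord p.1).inverse ++ evalWord p.2) [(0, false)]) =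
        [(0, false)] :=
    Primrec.eq.comp (primrec_reduce.comp (primrec_actWord.comp
      (Primrec.list_append.comp (primrec_inverse.comp (primrec_evalWord.comp .fst))
        (primrec_evalWord.comp .snd)) (.const _))) (.const _)
  obtain ⟨_, h⟩ := h.of_eq fun p => (ldCon_iff_reduce p.1 p.2).symm
  exact ⟨_, h.to_comp⟩

end Braid

theorem mainTheorem4 :
    -- the sub-left-shelf generated by any braid is free of rank 1, with that braid as its basis
    (∀ a : Braid, IsFreeShelfOn.{w} (fun _ : Unit => SubShelf.gen a)) ∧
    -- the special braids realize the free left-shelf of LD-classes of terms in one variable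
    (∃ φ : FreeShelf Unit →◃ SpecialBraid, Function.Bijective φ ∧
      φ (FreeShelf.of ()) = SubShelf.gen 1) ∧
    -- the evaluation of terms as braid words is computable
    Computable evalWord ∧
    -- the semantic algorithm is correct, and it is effective if the braid subroutine is
    (∀ equiv : BraidWord → BraidWord → Bool, SolvesBraidWordProblem equiv →
      (∀ t t' : Term1, semanticAlgorithm equiv t t' = true ↔ ldCon Unit t t') ∧
      (Computable₂ equiv → Computable₂ (semanticAlgorithm equiv))) ∧
    -- LD-equivalence of terms in one variable is decidable
    ComputablePred (fun p : Term1 × Term1 => ldCon Unit p.1 p.2) := by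
  refine ⟨fun a => ?_, ⟨_, Braid.lift_gen_bijective 1, rfl⟩, Braid.primrec_evalWord.to_comp,
    fun equiv h => ⟨Braid.semanticAlgorithm_eq_true_iff h, fun hc => ?_⟩,
    Braid.computablePred_ldCon⟩
  · exact (FreeShelf.isFreeShelfOn Unit).of_bijective _ (Braid.lift_gen_bijective a)
  · exact hc.comp (Braid.primrec_evalWord.to_comp.comp .fst)
      (Braid.primrec_evalWord.to_comp.comp .snd)
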